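/- A (closed) half-plane in $\mathbb{R}^3$ is a set $\{p+su+tv : s\in\mathbb{R},\ t\ge 0\}$ with $u,v$ linearly independent. Let $P\subset\mathbb{R}^3$ be a (not necessarily convex) polytope with triangulated faces: $P$ is compact, $P$ is the closure of its interior, $\operatorname{int}P$ is non-empty and connected, and $\partial P$ is the union of a finite set of non-degenerate triangles with pairwise disjoint relative interiors (the facial triangles). A finite set $\mathcal H$ of half-planes \emph{carves} $P$ if $\operatorname{int}P$ is a connected component of $\mathbb{R}^3\setminus\bigcup_{H\in\mathcal H}H$. For a plane $L$, a set $Q\subseteq L$ and a set $S$ of segments in $L$, the \emph{polygon separation problem} for $(Q,S)$ in $L$ asks for a convex polygon with the minimum number of sides that contains $Q$ and neither contains nor crosses a segment of $S$. The polygon is open and may be unbounded or have fewer than three sides; it is given by the half-planes its sides cut away. That is, one asks for a finite set $\mathcal K$ of closed half-planes contained in $L$, of minimum cardinality, such that $L\setminus\bigcup_{H\in\mathcal K}H$ contains $Q$ and is disjoint from every segment of $S$. Suppose that $P$ can be carved with some finite set of half-planes. Partition the facial triangles by coplanarity. For each class $\mathcal T$ of the partition, let $L_{\mathcal T}$ be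 the common plane of its triangles, let $Q_{\mathcal T}=\operatorname{int}P\cap L_{\mathcal T}$, and let $S_{\mathcal T}$ be the set of edges of triangles in $\mathcal T$. Then for each class $\mathcal T$ the polygon separation problem for $(Q_{\mathcal T},S_{\mathcal T})$ in $L_{\mathcal T}$ has an optimal solution; and for every choice of an optimal solution $\mathcal K_{\mathcal T}$ for each class, $\bigcup_{\mathcal T}\mathcal K_{\mathcal T}$ is a set of half-planes that carves $P$, of minimum cardinality among all finite sets of half-planes carving $P$. -/

import Mathlib

namespace PolytopeCarving

/-- Euclidean 3-space. -/
abbrev E3 : Type := EuclideanSpace ℝ (Fin 3)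

/-- `H` is a closed (two-dimensional) half-plane in 3-space: the points `p + s • u + t • v` with
`s` real and `t ≥ 0`, for linearly independent `u`, `v`. -/
def IsHalfPlane (H : Set E3) : Prop :=
  ∃ p u v : E3, LinearIndependent ℝ ![u, v] ∧
    H = {x | ∃ s t : ℝ, 0 ≤ t ∧ x = p + s • u + t • v}

/-- `P` is a (not necessarily convex) polytope in 3-space whose faces are triangulated, and `𝒯` is
the set of its facial triangles, each given by its three vertices: `P` is compact, it is the closure
of its interior, its interior is non-empty and connected, and its boundary is the union of the
finitely many non-degenerate triangles of `𝒯`, which do not overlap. -/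
structure IsTriangulatedPolytope (P : Set E3) (𝒯 : Set (Finset E3)) : Prop where
  isCompact : IsCompact P
  closure_interior : closure (interior P) = P
  isConnected_interior : IsConnected (interior P)
  finite : 𝒯.Finite
  card_eq : ∀ T ∈ 𝒯, T.card = 3
  affineIndependent : ∀ T ∈ 𝒯, AffineIndependent ℝ (fun x : T => (x : E3))
  interiors_disjoint : ∀ T ∈ 𝒯, ∀ T' ∈ 𝒯, T ≠ T' →
    Disjoint (intrinsicInterior ℝ (convexHull ℝ (T : Set E3)))
      (intrinsicInterior ℝ (convexHull ℝ (T' : Set E3)))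
  frontier_eq : frontier P = ⋃ T ∈ 𝒯, convexHull ℝ (T : Set E3)

/-- The finite set `𝓗` of half-planes carves `P`: the interior of `P` is a connected component of
the complement of the union of the half-planes. -/
def Carves (𝓗 : Set (Set E3)) (P : Set E3) : Prop :=
  𝓗.Finite ∧ (∀ H ∈ 𝓗, IsHalfPlane H) ∧
    ∃ x ∈ (⋃₀ 𝓗)ᶜ, connectedComponentIn (⋃₀ 𝓗)ᶜ x = interior P

/-- `P` can be carved with half-planes. -/
def IsCarveable (P : Set E3) : Prop := ∃ 𝓗 : Set (Set E3), Carves 𝓗 P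

/-- `𝓗` is a set of half-planes of minimum size among those carving `P`. -/
def IsMinCarving (𝓗 : Set (Set E3)) (P : Set E3) : Prop :=
  Carves 𝓗 P ∧ ∀ 𝓗' : Set (Set E3), Carves 𝓗' P → 𝓗.ncard ≤ 𝓗'.ncard

/-- The planes `L` of the classes of the partition of the facial triangles by coplanarity. -/
def facePlanes (𝒯 : Set (Finset E3)) : Set (AffineSubspace ℝ E3) :=
  {L | ∃ T ∈ 𝒯, affineSpan ℝ (T : Set E3) = L}

/-- The class of the partition by coplanarity that belongs to the plane `L`: the facial triangles
whose plane is `L`. -/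
def coplanarClass (𝒯 : Set (Finset E3)) (L : AffineSubspace ℝ E3) : Set (Finset E3) :=
  {T ∈ 𝒯 | affineSpan ℝ (T : Set E3) = L}

/-- The cross-section of the interior of `P` by the plane `L`. -/
def crossSection (P : Set E3) (L : AffineSubspace ℝ E3) : Set E3 :=
  interior P ∩ (L : Set E3)

/-- The set of edges (closed segments) of the triangles of `𝒯`. -/
def triangleEdges (𝒯 : Set (Finset E3)) : Set (Set E3) :=
  {e | ∃ T ∈ 𝒯, ∃ a ∈ T, ∃ b ∈ T, a ≠ b ∧ e = segment ℝ a b}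

/-- What a set `𝓚` of closed half-planes of the plane `L` leaves of `L`: the intersection of the
complementary open half-planes, an open convex polygon (possibly unbounded) whose sides lie on the
boundary lines of the half-planes. -/
def remainingPolygon (L : AffineSubspace ℝ E3) (𝓚 : Set (Set E3)) : Set E3 :=
  {x | x ∈ L ∧ ∀ H ∈ 𝓚, x ∉ H}

/-- Feasible solutions of the polygon separation problem in the plane `L` for the inner region `Q`
and the set `S` of outer segments: a convex polygon, given by the half-planes of `L` that its sides
cut away, which contains `Q` and neither contains nor crosses a segment of `S`. -/
def Separates (L : AffineSubspace ℝ E3) (Q : Set E3) (S : Set (Set E3))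
    (𝓚 : Set (Set E3)) : Prop :=
  𝓚.Finite ∧ (∀ H ∈ 𝓚, IsHalfPlane H ∧ H ⊆ (L : Set E3)) ∧
    Q ⊆ remainingPolygon L 𝓚 ∧ ∀ e ∈ S, Disjoint e (remainingPolygon L 𝓚)

/-- Optimal solutions of the polygon separation problem: feasible solutions with the minimum number
of sides. -/
def IsMinSeparation (L : AffineSubspace ℝ E3) (Q : Set E3) (S : Set (Set E3))
    (𝓚 : Set (Set E3)) : Prop :=
  Separates L Q S 𝓚 ∧ ∀ 𝓚' : Set (Set E3), Separates L Q S 𝓚' → 𝓚.ncard ≤ 𝓚'.ncard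

end PolytopeCarving

namespace PolytopeCarving

open Filter Topology

/-! A finite set of half-planes carves `P` exactly when it misses `interior P` and covers `frontier
P` (`Carves.disjoint_interior`, `Carves.frontier_subset`, `carves_of_frontier_subset`). A half-plane
not lying in the plane of a triangle covers only a thin part of it, so the half-planes lying in that
plane already cover the triangle (`exists_halfPlane_subset_plane`). Hence every carving restricts to
a feasible separation in each face plane. These restrictions are disjoint, since a half-plane
determines its plane, and summing cardinalities gives the lower bound.

Conversely, optimal separations cover every facial triangle (`IsMinSeparation.triangle_subset`). If
the cross-section is non-empty, a segment from it to an uncovered point of the triangle would stay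
in the convex polygon and yet meet an edge. If it is empty, optimality leaves at most one
half-plane, which contains the vertices and so the triangle. -/

/-! ### Half-planes and the planes containing them -/

theorem IsHalfPlane.isClosed {H : Set E3} (hH : IsHalfPlane H) : IsClosed H := by
  obtain ⟨p, u, v, huv, rfl⟩ := hH
  have hinj : Function.Injective (Fintype.linearCombination ℝ ![u, v]) :=
    linearIndependent_iff_injective_fintypeLinearCombination.mp huv
  have hemb := LinearMap.isClosedEmbedding_of_injective (LinearMap.ker_eq_bot.mpr hinj)
  have hcl : IsClosed {w : Fin 2 → ℝ | 0 ≤ w 1} :=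
    isClosed_le continuous_const (continuous_apply 1)
  have him := hemb.isClosedMap _ hcl
  convert (Homeomorph.addLeft p).isClosedMap _ him using 1
  ext x
  simp only [Set.mem_ofPred_eq, Set.mem_image, Homeomorph.coe_addLeft]
  constructor
  · rintro ⟨s, t, ht, rfl⟩
    refine ⟨s • u + t • v, ⟨![s, t], by simpa using ht, ?_⟩, by abel⟩
    simp [Fintype.linearCombination_apply, Fin.sum_univ_two]
  · rintro ⟨_, ⟨w, hw, rfl⟩, rfl⟩
    exact ⟨w 0, w 1, hw, by simp [Fintype.linearCombination_apply, Fin.sum_univ_two, add_assoc]⟩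

theorem IsHalfPlane.convex {H : Set E3} (hH : IsHalfPlane H) : Convex ℝ H := by
  obtain ⟨p, u, v, -, rfl⟩ := hH
  rintro _ ⟨s, t, ht, rfl⟩ _ ⟨s', t', ht', rfl⟩ a b ha hb hab
  refine ⟨a * s + b * s', a * t + b * t', by positivity, ?_⟩
  obtain rfl : b = 1 - a := by linarith
  module

theorem finrank_span_pair {u v : E3} (h : LinearIndependent ℝ ![u, v]) :
    Module.finrank ℝ (Submodule.span ℝ {u, v}) = 2 := by
  have := finrank_span_eq_card h
  rw [Matrix.range_cons, Matrix.range_cons, Matrix.range_empty, Set.union_empty,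
    Set.singleton_union] at this
  simpa using this

theorem coeff_eq_of_linearIndependent {u v p : E3} (h : LinearIndependent ℝ ![u, v])
    {s t s' t' : ℝ} (he : p + s • u + t • v = p + s' • u + t' • v) : s = s' ∧ t = t' := by
  rw [LinearIndependent.pair_iff] at h
  have := h (s - s') (t - t') (by
    have h2 : s • u + t • v = s' • u + t' • v := by
      simpa [add_assoc] using he
    rw [sub_smul, sub_smul, sub_add_sub_comm, h2, sub_self])
  exact ⟨by linarith [this.1], by linarith [this.2]⟩

/-- A half-plane contained in a plane spans it. -/
theorem direction_eq_span {L : AffineSubspace ℝ E3} (hL : Module.finrank ℝ L.direction = 2)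
    {p u v : E3} (huv : LinearIndependent ℝ ![u, v])
    (hH : {x | ∃ s t : ℝ, 0 ≤ t ∧ x = p + s • u + t • v} ⊆ (L : Set E3)) :
    p ∈ L ∧ L.direction = Submodule.span ℝ {u, v} := by
  have hp : p ∈ L := hH ⟨0, 0, le_rfl, by simp⟩
  have hu : p + u ∈ L := hH ⟨1, 0, le_rfl, by simp⟩
  have hv : p + v ∈ L := hH ⟨0, 1, zero_le_one, by simp⟩
  refine ⟨hp, (Submodule.eq_of_le_of_finrank_eq ?_ ?_).symm⟩
  · rw [Submodule.span_le]
    rintro x (rfl | rfl)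
    · simpa using AffineSubspace.vsub_mem_direction hu hp
    · simpa using AffineSubspace.vsub_mem_direction hv hp
  · rw [hL, finrank_span_pair huv]

theorem exists_coords {L : AffineSubspace ℝ E3} {p u v : E3} (hp : p ∈ L)
    (hd : L.direction = Submodule.span ℝ {u, v}) {x : E3} (hx : x ∈ L) :
    ∃ s t : ℝ, x = p + s • u + t • v := by
  have h := AffineSubspace.vsub_mem_direction hx hp
  rw [hd, Submodule.mem_span_pair] at h
  obtain ⟨s, t, h⟩ := h
  refine ⟨s, t, ?_⟩
  rw [add_assoc, h]
  simp

theorem mem_of_coords {L : AffineSubspace ℝ E3} {p u v : E3} (hp : p ∈ L)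
    (hd : L.direction = Submodule.span ℝ {u, v}) (s t : ℝ) : p + s • u + t • v ∈ L := by
  have h : s • u + t • v ∈ L.direction := by
    rw [hd, Submodule.mem_span_pair]
    exact ⟨s, t, rfl⟩
  have := AffineSubspace.vadd_mem_of_mem_direction h hp
  rwa [vadd_eq_add, add_comm, ← add_assoc] at this

/-- Two planes containing a common half-plane coincide. -/
theorem plane_unique {L L' : AffineSubspace ℝ E3} (hL : Module.finrank ℝ L.direction = 2)
    (hL' : Module.finrank ℝ L'.direction = 2) {H : Set E3} (hH : IsHalfPlane H)
    (h : H ⊆ (L : Set E3)) (h' : H ⊆ (L' : Set E3)) : L = L' := by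
  obtain ⟨p, u, v, huv, rfl⟩ := hH
  obtain ⟨hp, hd⟩ := direction_eq_span hL huv h
  obtain ⟨hp', hd'⟩ := direction_eq_span hL' huv h'
  exact AffineSubspace.ext_of_direction_eq (hd.trans hd'.symm) ⟨p, hp, hp'⟩

/-- In the affine coordinates `(s, t)` of the plane, the complement is `t < 0`. -/
theorem convex_diff_halfPlane {L : AffineSubspace ℝ E3}
    (hL : Module.finrank ℝ L.direction = 2) {H : Set E3} (hH : IsHalfPlane H)
    (h : H ⊆ (L : Set E3)) : Convex ℝ ((L : Set E3) \ H) := by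
  obtain ⟨p, u, v, huv, rfl⟩ := hH
  obtain ⟨hp, hd⟩ := direction_eq_span hL huv h
  rintro x ⟨hx, hxH⟩ y ⟨hy, hyH⟩ a b ha hb hab
  refine ⟨L.convex hx hy ha hb hab, ?_⟩
  obtain ⟨s, t, rfl⟩ := exists_coords hp hd hx
  obtain ⟨s', t', rfl⟩ := exists_coords hp hd hy
  have ht : t < 0 := not_le.mp fun h0 => hxH ⟨s, t, h0, rfl⟩
  have ht' : t' < 0 := not_le.mp fun h0 => hyH ⟨s', t', h0, rfl⟩
  rintro ⟨s'', t'', h0, he⟩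
  obtain rfl : b = 1 - a := by linarith
  have he' : p + (a * s + (1 - a) * s') • u + (a * t + (1 - a) * t') • v =
      p + s'' • u + t'' • v := by
    rw [← he]
    module
  have := (coeff_eq_of_linearIndependent huv he').2
  rcases ha.eq_or_lt with rfl | ha
  · simp at this
    linarith
  · nlinarith

theorem convex_remainingPolygon {L : AffineSubspace ℝ E3}
    (hL : Module.finrank ℝ L.direction = 2) {𝓚 : Set (Set E3)}
    (h𝓚 : ∀ H ∈ 𝓚, IsHalfPlane H ∧ H ⊆ (L : Set E3)) :
    Convex ℝ (remainingPolygon L 𝓚) := by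
  intro x hx y hy a b ha hb hab
  exact ⟨L.convex hx.1 hy.1 ha hb hab, fun H hH =>
    (convex_diff_halfPlane hL (h𝓚 H hH).1 (h𝓚 H hH).2
      ⟨hx.1, hx.2 H hH⟩ ⟨hy.1, hy.2 H hH⟩ ha hb hab).2⟩

/-! ### Triangles and their edges -/

theorem exists_vertices {T : Finset E3} (hc : T.card = 3)
    (hT : AffineIndependent ℝ (fun x : T => (x : E3))) :
    ∃ a b c : E3, T = {a, b, c} ∧ a ≠ b ∧ a ≠ c ∧ b ≠ c ∧
      LinearIndependent ℝ ![b - a, c - a] ∧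
      (affineSpan ℝ (T : Set E3)).direction = Submodule.span ℝ {b - a, c - a} := by
  obtain ⟨a, b, c, hab, hac, hbc, rfl⟩ := Finset.card_eq_three.mp hc
  have hfr : Module.finrank ℝ (vectorSpan ℝ (({a, b, c} : Finset E3) : Set E3)) = 2 := by
    have := hT.finrank_vectorSpan (n := 2) (by simp [hab, hac, hbc])
    rw [Subtype.range_coe_subtype] at this
    exact this
  have hd : vectorSpan ℝ (({a, b, c} : Finset E3) : Set E3) =
      Submodule.span ℝ {b - a, c - a} := by
    rw [vectorSpan_eq_span_vsub_set_right (p := a) ℝ (by simp)]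
    simp [Set.image_insert_eq, Submodule.span_insert_zero]
  refine ⟨a, b, c, rfl, hab, hac, hbc, ?_, ?_⟩
  · rw [linearIndependent_iff_card_eq_finrank_span, Set.finrank]
    rw [hd] at hfr
    rw [Matrix.range_cons, Matrix.range_cons, Matrix.range_empty, Set.union_empty,
      Set.singleton_union, hfr, Fintype.card_fin]
  · rw [direction_affineSpan, hd]

theorem finrank_direction_affineSpan {T : Finset E3} (hc : T.card = 3)
    (hT : AffineIndependent ℝ (fun x : T => (x : E3))) :
    Module.finrank ℝ (affineSpan ℝ (T : Set E3)).direction = 2 := by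
  obtain ⟨a, b, c, -, -, -, -, hli, hd⟩ := exists_vertices hc hT
  rw [hd, finrank_span_pair hli]

theorem mem_convexHull_triple {a b c x : E3} : x ∈ convexHull ℝ {a, b, c} ↔
    ∃ r s t : ℝ, 0 ≤ r ∧ 0 ≤ s ∧ 0 ≤ t ∧ r + s + t = 1 ∧ x = r • a + s • b + t • c := by
  constructor
  · have hsub : convexHull ℝ {a, b, c} ⊆ {x : E3 | ∃ r s t : ℝ, 0 ≤ r ∧ 0 ≤ s ∧ 0 ≤ t ∧
        r + s + t = 1 ∧ x = r • a + s • b + t • c} := by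
      refine convexHull_min ?_ ?_
      · rintro _ (rfl | rfl | rfl)
        · exact ⟨1, 0, 0, by simp⟩
        · exact ⟨0, 1, 0, by simp⟩
        · exact ⟨0, 0, 1, by simp⟩
      · rintro _ ⟨r, s, t, hr, hs, ht, h, rfl⟩ _ ⟨r', s', t', hr', hs', ht', h', rfl⟩ p q hp hq hpq
        refine ⟨p * r + q * r', p * s + q * s', p * t + q * t', by positivity, by positivity,
          by positivity, ?_, by module⟩
        linear_combination p * h + q * h' + hpq
    exact fun h => hsub h
  · rintro ⟨r, s, t, hr, hs, ht, h, rfl⟩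
    have := (convex_convexHull ℝ {a, b, c}).sum_mem (t := Finset.univ) (w := ![r, s, t])
      (z := ![a, b, c]) (by simp [Fin.forall_fin_succ, hr, hs, ht])
      (by simp [Fin.sum_univ_three, h])
      (by
        have hsub := subset_convexHull ℝ ({a, b, c} : Set E3)
        simp only [Set.insert_subset_iff, Set.singleton_subset_iff] at hsub
        simp [Fin.forall_fin_succ, hsub])
    simpa [Fin.sum_univ_three] using this

/-- A segment from a triangle to a point of its plane outside it meets an edge of the triangle. -/
theorem exists_mem_edge {a b c x y : E3} (hx : x ∈ convexHull ℝ {a, b, c})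
    (hy : ∃ s t : ℝ, y = a + s • (b - a) + t • (c - a)) (hyT : y ∉ convexHull ℝ {a, b, c}) :
    ∃ z ∈ segment ℝ x y, z ∈ segment ℝ a b ∨ z ∈ segment ℝ a c ∨ z ∈ segment ℝ b c := by
  obtain ⟨r, s, t, hr, hs, ht, h, rfl⟩ := mem_convexHull_triple.mp hx
  obtain ⟨s', t', rfl⟩ := hy
  -- Barycentric coordinates of the point at parameter `τ` on the segment from `x` to `y`. Their
  -- minimum passes from nonnegative to nonpositive; where it is zero, the point lies on an edge.
  let f : ℝ → ℝ := fun τ => (1 - τ) * r + τ * (1 - s' - t')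
  let g : ℝ → ℝ := fun τ => (1 - τ) * s + τ * s'
  let k : ℝ → ℝ := fun τ => (1 - τ) * t + τ * t'
  have hcont : Continuous fun τ => min (f τ) (min (g τ) (k τ)) := by fun_prop
  have h0 : 0 ≤ min (f 0) (min (g 0) (k 0)) := by simp [f, g, k, hr, hs, ht]
  have h1 : min (f 1) (min (g 1) (k 1)) ≤ 0 := by
    by_contra! hpos
    simp only [lt_min_iff, f, g, k] at hpos
    refine hyT (mem_convexHull_triple.mpr ⟨1 - s' - t', s', t', by linarith, by linarith,
      by linarith, by ring, by module⟩)
  obtain ⟨τ, ⟨hτ0, hτ1⟩, hτ⟩ :=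
    intermediate_value_Icc' zero_le_one hcont.continuousOn ⟨h1, h0⟩
  have hle := hτ.ge
  simp only [le_min_iff] at hle
  obtain ⟨hf, hg, hk⟩ := hle
  have hsum : f τ + g τ + k τ = 1 := by
    simp only [f, g, k]
    linear_combination (1 - τ) * h
  refine ⟨f τ • a + g τ • b + k τ • c, ⟨1 - τ, τ, by linarith, hτ0, by ring, ?_⟩, ?_⟩
  · simp only [f, g, k]
    module
  · have hzero : f τ = 0 ∨ g τ = 0 ∨ k τ = 0 := by
      rcases min_choice (f τ) (min (g τ) (k τ)) with h2 | h2
      · exact Or.inl (h2.symm.trans hτ)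
      · rcases min_choice (g τ) (k τ) with h3 | h3
        · exact Or.inr (Or.inl (h3.symm.trans (h2.symm.trans hτ)))
        · exact Or.inr (Or.inr (h3.symm.trans (h2.symm.trans hτ)))
    rcases hzero with h2 | h2 | h2 <;> rw [h2] at hsum ⊢
    · exact Or.inr (Or.inr ⟨_, _, hg, hk, by linarith, by simp⟩)
    · exact Or.inr (Or.inl ⟨_, _, hf, hk, by linarith, by simp⟩)
    · exact Or.inl ⟨_, _, hf, hg, by linarith, by simp⟩

/-! ### Covering a triangle by half-planes -/

/-- A half-plane lies on a level set of a linear functional, and a plane on the same level set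
contains the half-plane. -/
theorem exists_linearMap_of_halfPlane {H : Set E3} (hH : IsHalfPlane H) :
    ∃ (f : E3 →ₗ[ℝ] ℝ) (r : ℝ), (∀ x ∈ H, f x = r) ∧
      ∀ L : AffineSubspace ℝ E3, Module.finrank ℝ L.direction = 2 →
        (∀ x ∈ L, f x = r) → H ⊆ (L : Set E3) := by
  obtain ⟨p, u, v, huv, rfl⟩ := hH
  have hspan := finrank_span_pair huv
  have hlt : Submodule.span ℝ {u, v} < ⊤ := by
    refine lt_top_iff_ne_top.mpr fun he => ?_
    rw [he, finrank_top, finrank_euclideanSpace_fin] at hspan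
    norm_num at hspan
  obtain ⟨f, hf, hle⟩ := Submodule.exists_le_ker_of_lt_top _ hlt
  have hker : Module.finrank ℝ (LinearMap.ker f) = 2 := by
    have h1 := Submodule.finrank_mono hle
    have h2 : Module.finrank ℝ (LinearMap.ker f) < Module.finrank ℝ E3 :=
      Submodule.finrank_lt fun he => hf (LinearMap.ker_eq_top.mp he)
    rw [finrank_euclideanSpace_fin] at h2
    omega
  have hu : f u = 0 := hle (Submodule.subset_span (by simp))
  have hv : f v = 0 := hle (Submodule.subset_span (by simp))
  refine ⟨f, f p, ?_, ?_⟩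
  · rintro _ ⟨s, t, -, rfl⟩
    simp [hu, hv]
  · intro L hL hfL
    have hne : (L : Set E3).Nonempty := by
      by_contra hemp
      rw [Set.not_nonempty_iff_eq_empty, AffineSubspace.coe_eq_bot_iff] at hemp
      rw [hemp, AffineSubspace.direction_bot, finrank_bot] at hL
      norm_num at hL
    obtain ⟨q, hq⟩ := hne
    have hdir : L.direction = LinearMap.ker f := by
      refine Submodule.eq_of_le_of_finrank_eq (fun w hw => ?_) (hL.trans hker.symm)
      have := hfL _ (AffineSubspace.vadd_mem_of_mem_direction hw hq)
      rw [vadd_eq_add, map_add, hfL q hq] at this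
      simpa using this
    rintro _ ⟨s, t, -, rfl⟩
    have hmem : p + s • u + t • v - q ∈ L.direction := by
      rw [hdir, LinearMap.mem_ker]
      simp [hu, hv, hfL q hq]
    simpa using AffineSubspace.vadd_mem_of_mem_direction hmem hq

/-- The left side is a polynomial in `t` with infinitely many roots, hence zero; its values at 0, 1,
-1 and 2 then determine the coefficients. -/
theorem cubic_coeffs_eq_zero_of_frequently {A B C D : ℝ}
    (h : ∃ᶠ t : ℝ in 𝓝[>] 0, A * (1 - t - t ^ 2 - t ^ 3) + B * t + C * t ^ 2 + D * t ^ 3 = 0) :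
    B = 0 ∧ C = 0 ∧ D = 0 := by
  let q : Polynomial ℝ := .C A * (1 - .X - .X ^ 2 - .X ^ 3) + .C B * .X + .C C * .X ^ 2 +
    .C D * .X ^ 3
  have heval : ∀ t, q.eval t =
      A * (1 - t - t ^ 2 - t ^ 3) + B * t + C * t ^ 2 + D * t ^ 3 := by
    intro t
    simp [q]
  have hq : q = 0 := by
    refine Polynomial.eq_zero_of_infinite_isRoot q fun hfin => h ?_
    have := (hfin.sdiff (t := {0})).isClosed.isOpen_compl.mem_nhds (x := (0 : ℝ)) (by simp)
    filter_upwards [mem_nhdsWithin_of_mem_nhds this, self_mem_nhdsWithin] with t ht ht0 hz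
    exact ht ⟨(heval t).trans hz, (Set.mem_Ioi.mp ht0).ne'⟩
  have h0 := heval 0
  have h1 := heval 1
  have h2 := heval (-1)
  have h3 := heval 2
  rw [hq, Polynomial.eval_zero] at h0 h1 h2 h3
  refine ⟨?_, ?_, ?_⟩ <;> linarith

/-- A triangle covered by finitely many half-planes is covered by those lying in its plane. -/
theorem exists_halfPlane_subset_plane {𝓗 : Set (Set E3)} (hfin : 𝓗.Finite)
    (hhp : ∀ H ∈ 𝓗, IsHalfPlane H) {T : Finset E3} (hc : T.card = 3)
    (hT : AffineIndependent ℝ (fun x : T => (x : E3)))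
    (hcov : convexHull ℝ (T : Set E3) ⊆ ⋃₀ 𝓗) {x : E3} (hx : x ∈ convexHull ℝ (T : Set E3)) :
    ∃ H ∈ 𝓗, H ⊆ (affineSpan ℝ (T : Set E3) : Set E3) ∧ x ∈ H := by
  obtain ⟨a, b, c, hTe, -, -, -, hli, hd⟩ := exists_vertices hc hT
  have hfr := finrank_direction_affineSpan hc hT
  have hco : (T : Set E3) = {a, b, c} := by simp [hTe]
  have haL : a ∈ affineSpan ℝ (T : Set E3) := subset_affineSpan ℝ _ (by simp [hTe])
  -- A curve starting at `x` and running in the triangle for small `t > 0`. The independent powers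
  -- of `t` ensure that a plane meeting it for infinitely many `t` contains `a`, `b` and `c`.
  let γ : ℝ → E3 := fun t => (1 - t - t ^ 2 - t ^ 3) • x + t • a + t ^ 2 • b + t ^ 3 • c
  have hγ : ∀ᶠ t in 𝓝[>] (0 : ℝ), γ t ∈ convexHull ℝ (T : Set E3) := by
    filter_upwards [Ioo_mem_nhdsGT (show (0 : ℝ) < 1 / 3 by norm_num)] with t ht
    rw [hco] at hx ⊢
    obtain ⟨r, s, w, hr, hs, hw, h, rfl⟩ := mem_convexHull_triple.mp hx
    have ht0 := ht.1
    have hm : 0 ≤ 1 - t - t ^ 2 - t ^ 3 := by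
      have h2 : t ^ 2 ≤ t := by nlinarith [ht.1, ht.2]
      have h3 : t ^ 3 ≤ t ^ 2 := by nlinarith [ht.1, ht.2, sq_nonneg t]
      linarith [ht.2]
    refine mem_convexHull_triple.mpr ⟨(1 - t - t ^ 2 - t ^ 3) * r + t,
      (1 - t - t ^ 2 - t ^ 3) * s + t ^ 2, (1 - t - t ^ 2 - t ^ 3) * w + t ^ 3,
      by positivity, by positivity, by positivity, ?_, ?_⟩
    · linear_combination (1 - t - t ^ 2 - t ^ 3) * h
    · simp only [γ]
      module
  -- Pigeonhole: one of the finitely many half-planes contains `γ t` for `t` arbitrarily close to 0.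
  -- Being closed, it also contains the limit `x`.
  obtain ⟨H, hH, hfreq⟩ : ∃ H ∈ 𝓗, ∃ᶠ t in 𝓝[>] (0 : ℝ), γ t ∈ H := by
    by_contra! hcon
    have hall := (eventually_all_finite hfin).mpr hcon
    obtain ⟨t, ht, htn⟩ := (hγ.and hall).exists
    obtain ⟨H, hH, hmem⟩ := hcov ht
    exact htn H hH hmem
  refine ⟨H, hH, ?_, ?_⟩
  · obtain ⟨f, r, hfH, hfL⟩ := exists_linearMap_of_halfPlane (hhp H hH)
    refine hfL _ hfr fun y hy => ?_
    -- The weights in `γ` sum to 1, so `r` can be subtracted from each value of `f`.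
    obtain ⟨h1, h2, h3⟩ := cubic_coeffs_eq_zero_of_frequently
      (A := f x - r) (B := f a - r) (C := f b - r) (D := f c - r)
      (hfreq.mono fun t ht => by
        have := hfH _ ht
        simp only [γ, map_add, map_smul, smul_eq_mul] at this
        linear_combination this)
    obtain ⟨s, t, rfl⟩ := exists_coords haL hd hy
    simp only [map_add, map_sub, map_smul, smul_eq_mul]
    linear_combination h1 + s * (h2 - h1) + t * (h3 - h1)
  · have hcont : Continuous γ := by fun_prop
    have hlim : Tendsto γ (𝓝[>] 0) (𝓝 x) := by
      have := (hcont.tendsto 0).mono_left (nhdsWithin_le_nhds (s := Set.Ioi 0))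
      simpa [γ] using this
    exact (hhp H hH).isClosed.mem_of_frequently_of_tendsto hfreq hlim

/-! ### Carving as covering the boundary -/

theorem Carves.disjoint_interior {𝓗 : Set (Set E3)} {P : Set E3} (h : Carves 𝓗 P) :
    interior P ⊆ (⋃₀ 𝓗)ᶜ := by
  obtain ⟨-, -, x, hx, he⟩ := h
  rw [← he]
  exact connectedComponentIn_subset _ _

/-- Around an uncovered boundary point some ball misses all the half-planes. It meets `interior P`,
so it lies in that component, putting a boundary point in the interior. -/
theorem Carves.frontier_subset {𝓗 : Set (Set E3)} {P : Set E3} (h : Carves 𝓗 P)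
    (hP : closure (interior P) = P) : frontier P ⊆ ⋃₀ 𝓗 := by
  obtain ⟨hfin, hhp, x, hx, he⟩ := h
  intro y hy
  by_contra hyn
  have hcl : IsClosed (⋃₀ 𝓗) := by
    rw [Set.sUnion_eq_biUnion]
    exact hfin.isClosed_biUnion fun H hH => (hhp H hH).isClosed
  obtain ⟨ε, hε, hball⟩ := Metric.isOpen_iff.mp hcl.isOpen_compl y hyn
  have hPc : IsClosed P := hP ▸ isClosed_closure
  have hyP : y ∈ closure (interior P) := by
    rw [hP]
    exact hPc.frontier_subset hy
  obtain ⟨z, hz, hzy⟩ := Metric.mem_closure_iff.mp hyP ε hε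
  have hzb : z ∈ Metric.ball y ε := by rwa [Metric.mem_ball, dist_comm]
  have hsub : Metric.ball y ε ⊆ connectedComponentIn (⋃₀ 𝓗)ᶜ z :=
    (convex_ball y ε).isPreconnected.subset_connectedComponentIn hzb hball
  rw [← connectedComponentIn_eq (he ▸ hz : z ∈ connectedComponentIn (⋃₀ 𝓗)ᶜ x), he] at hsub
  exact hy.2 (hsub (Metric.mem_ball_self hε))

/-- A finite set of half-planes avoiding the interior of `P` and covering its boundary carves
`P`. -/
theorem carves_of_frontier_subset {𝓗 : Set (Set E3)} {P : Set E3} (hfin : 𝓗.Finite)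
    (hhp : ∀ H ∈ 𝓗, IsHalfPlane H) (hconn : IsConnected (interior P))
    (hint : interior P ⊆ (⋃₀ 𝓗)ᶜ) (hfr : frontier P ⊆ ⋃₀ 𝓗) : Carves 𝓗 P := by
  obtain ⟨x, hx⟩ := hconn.nonempty
  refine ⟨hfin, hhp, x, hint hx, Set.Subset.antisymm ?_ ?_⟩
  · intro y hy
    by_contra hyn
    -- The component avoids the covered boundary, so the interior and the exterior are two open sets
    -- covering it.
    have hsub : connectedComponentIn (⋃₀ 𝓗)ᶜ x ⊆ interior P ∪ (closure (interior P))ᶜ := by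
      intro z hz
      by_contra hzn
      rw [Set.mem_union, Set.mem_compl_iff, not_or, not_not] at hzn
      refine connectedComponentIn_subset _ _ hz (hfr (frontier_interior_subset ?_))
      exact ⟨hzn.2, by simpa using hzn.1⟩
    obtain ⟨z, -, hz, hzn⟩ := isPreconnected_connectedComponentIn _ _ isOpen_interior
      isClosed_closure.isOpen_compl hsub ⟨x, mem_connectedComponentIn (hint hx), hx⟩
      ⟨y, hy, (hsub hy).resolve_left hyn⟩
    exact hzn (subset_closure hz)
  · exact hconn.isPreconnected.subset_connectedComponentIn hx hint

/-! ### Carvings and separation problems -/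

theorem finrank_of_mem_facePlanes {P : Set E3} {𝒯 : Set (Finset E3)}
    (hP : IsTriangulatedPolytope P 𝒯) {L : AffineSubspace ℝ E3} (hL : L ∈ facePlanes 𝒯) :
    Module.finrank ℝ L.direction = 2 := by
  obtain ⟨T, hT, rfl⟩ := hL
  exact finrank_direction_affineSpan (hP.card_eq T hT) (hP.affineIndependent T hT)

theorem IsTriangulatedPolytope.triangle_subset_frontier {P : Set E3} {𝒯 : Set (Finset E3)}
    (hP : IsTriangulatedPolytope P 𝒯) {T : Finset E3} (hT : T ∈ 𝒯) :
    convexHull ℝ (T : Set E3) ⊆ frontier P := by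
  rw [hP.frontier_eq]
  exact Set.subset_biUnion_of_mem (u := fun T : Finset E3 => convexHull ℝ (T : Set E3)) hT

/-- The half-planes of a carving that lie in the plane of a facial triangle solve the polygon
separation problem of that plane. -/
theorem Carves.separates {𝓗 : Set (Set E3)} {P : Set E3} {𝒯 : Set (Finset E3)}
    (h : Carves 𝓗 P) (hP : IsTriangulatedPolytope P 𝒯) (L : AffineSubspace ℝ E3) :
    Separates L (crossSection P L) (triangleEdges (coplanarClass 𝒯 L))
      {H ∈ 𝓗 | H ⊆ (L : Set E3)} := by
  refine ⟨h.1.subset (Set.sep_subset _ _), fun H hH => ⟨h.2.1 H hH.1, hH.2⟩, ?_, ?_⟩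
  · rintro x ⟨hx, hxL⟩
    exact ⟨hxL, fun H hH hxH => h.disjoint_interior hx ⟨H, hH.1, hxH⟩⟩
  · rintro _ ⟨T, ⟨hT, rfl⟩, a, ha, b, hb, -, rfl⟩
    rw [Set.disjoint_left]
    intro x hx hxR
    have hxT : x ∈ convexHull ℝ (T : Set E3) :=
      (convex_convexHull ℝ _).segment_subset (subset_convexHull ℝ _ ha)
        (subset_convexHull ℝ _ hb) hx
    obtain ⟨H, hH, hHL, hxH⟩ := exists_halfPlane_subset_plane h.1 h.2.1 (hP.card_eq T hT)
      (hP.affineIndependent T hT)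
      ((hP.triangle_subset_frontier hT).trans (h.frontier_subset hP.closure_interior)) hxT
    exact hxR.2 H ⟨hH, hHL⟩ hxH

/-- Finitely many points of a plane lie in a common half-plane of it. -/
theorem exists_halfPlane_of_finite {p u v : E3} (huv : LinearIndependent ℝ ![u, v])
    {L : AffineSubspace ℝ E3} (hp : p ∈ L) (hd : L.direction = Submodule.span ℝ {u, v})
    {V : Set E3} (hV : V.Finite) (hVL : V ⊆ (L : Set E3)) :
    ∃ H, IsHalfPlane H ∧ H ⊆ (L : Set E3) ∧ V ⊆ H := by
  choose! s t hst using fun x (hx : x ∈ V) => exists_coords hp hd (hVL hx)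
  -- The half-plane starts at a lower bound `m` of the finitely many `t`-coordinates.
  obtain ⟨m, hm⟩ := (hV.image t).bddBelow
  refine ⟨_, ⟨p + m • v, u, v, huv, rfl⟩, ?_, ?_⟩
  · rintro _ ⟨s, t, -, rfl⟩
    have := mem_of_coords hp hd s (t + m)
    have he : p + m • v + s • u + t • v = p + s • u + (t + m) • v := by module
    exact he ▸ this
  · intro x hx
    refine ⟨s x, t x - m, sub_nonneg.mpr (hm ⟨x, hx, rfl⟩), ?_⟩
    conv_lhs => rw [hst x hx]
    module

/-- If no part of the interior of `P` lies in the plane, one half-plane is enough. -/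
theorem ncard_le_one_of_isMinSeparation {P : Set E3} {𝒯 : Set (Finset E3)}
    (hP : IsTriangulatedPolytope P 𝒯) {L : AffineSubspace ℝ E3} (hL : L ∈ facePlanes 𝒯)
    (hQ : crossSection P L = ∅) {𝓚 : Set (Set E3)}
    (h : IsMinSeparation L (crossSection P L) (triangleEdges (coplanarClass 𝒯 L)) 𝓚) :
    𝓚.ncard ≤ 1 := by
  obtain ⟨T, hT, rfl⟩ := hL
  obtain ⟨a, b, c, hTe, -, -, -, hli, hd⟩ :=
    exists_vertices (hP.card_eq T hT) (hP.affineIndependent T hT)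
  have ha : a ∈ affineSpan ℝ (T : Set E3) := subset_affineSpan ℝ _ (by simp [hTe])
  obtain ⟨H, hH, hHL, hV⟩ := exists_halfPlane_of_finite hli ha hd
    (V := ⋃ T' ∈ coplanarClass 𝒯 (affineSpan ℝ (T : Set E3)), (T' : Set E3))
    ((hP.finite.subset (Set.sep_subset _ _)).biUnion fun T' _ => T'.finite_toSet)
    (Set.iUnion₂_subset fun T' hT' => by
      rw [← hT'.2]
      exact subset_affineSpan ℝ _)
  have hsep : Separates (affineSpan ℝ (T : Set E3)) (crossSection P (affineSpan ℝ (T : Set E3)))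
      (triangleEdges (coplanarClass 𝒯 (affineSpan ℝ (T : Set E3)))) {H} := by
    refine ⟨Set.finite_singleton H, ?_, ?_, ?_⟩
    · rintro _ rfl
      exact ⟨hH, hHL⟩
    · rw [hQ]
      exact Set.empty_subset _
    · rintro _ ⟨T', hT', a', ha', b', hb', -, rfl⟩
      rw [Set.disjoint_left]
      intro x hx hxR
      exact hxR.2 H rfl (hH.convex.segment_subset (hV (Set.mem_biUnion hT' ha'))
        (hV (Set.mem_biUnion hT' hb')) hx)
  simpa using h.2 _ hsep

/-- Optimal solutions of the separation problems cover the facial triangles. -/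
theorem IsMinSeparation.triangle_subset {P : Set E3} {𝒯 : Set (Finset E3)}
    (hP : IsTriangulatedPolytope P 𝒯) {T : Finset E3} (hT : T ∈ 𝒯) {𝓚 : Set (Set E3)}
    (h : IsMinSeparation (affineSpan ℝ (T : Set E3)) (crossSection P (affineSpan ℝ (T : Set E3)))
      (triangleEdges (coplanarClass 𝒯 (affineSpan ℝ (T : Set E3)))) 𝓚) :
    convexHull ℝ (T : Set E3) ⊆ ⋃₀ 𝓚 := by
  have hfr := finrank_direction_affineSpan (hP.card_eq T hT) (hP.affineIndependent T hT)
  obtain ⟨a, b, c, hTe, hab, hac, hbc, hli, hd⟩ :=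
    exists_vertices (hP.card_eq T hT) (hP.affineIndependent T hT)
  have hTL : T ∈ coplanarClass 𝒯 (affineSpan ℝ (T : Set E3)) := ⟨hT, rfl⟩
  have hedge : ∀ p ∈ T, ∀ q ∈ T, p ≠ q →
      Disjoint (segment ℝ p q) (remainingPolygon (affineSpan ℝ (T : Set E3)) 𝓚) :=
    fun p hp q hq hpq => h.1.2.2.2 _ ⟨T, hTL, p, hp, q, hq, hpq, rfl⟩
  have haT : a ∈ T := by simp [hTe]
  have hbT : b ∈ T := by simp [hTe]
  have hcT : c ∈ T := by simp [hTe]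
  rcases (crossSection P (affineSpan ℝ (T : Set E3))).eq_empty_or_nonempty with hQ | ⟨y, hy⟩
  -- Optimality is essential here: with no cross-section to contain, a merely feasible polygon could
  -- lie strictly inside the triangle.
  · have hcard := ncard_le_one_of_isMinSeparation hP ⟨T, hT, rfl⟩ hQ h
    rw [Set.ncard_le_one h.1.1] at hcard
    have hvert : ∀ p ∈ T, ∃ H ∈ 𝓚, p ∈ H := by
      intro p hp
      obtain ⟨q, hq, hqp⟩ : ∃ q ∈ T, p ≠ q := by
        by_cases hpa : p = a
        · exact ⟨b, hbT, hpa ▸ hab⟩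
        · exact ⟨a, haT, hpa⟩
      by_contra! hcon
      exact Set.disjoint_left.mp (hedge p hp q hq hqp) (left_mem_segment ℝ p q)
        ⟨subset_affineSpan ℝ _ hp, hcon⟩
    obtain ⟨H, hH, -⟩ := hvert a haT
    refine (convexHull_min ?_ (h.1.2.1 H hH).1.convex).trans (Set.subset_sUnion_of_mem hH)
    intro p hp
    obtain ⟨H', hH', hp'⟩ := hvert p hp
    rwa [hcard H hH H' hH']
  · intro x hx
    by_contra hxn
    have hxR : x ∈ remainingPolygon (affineSpan ℝ (T : Set E3)) 𝓚 :=
      ⟨convexHull_subset_affineSpan _ hx, fun H hH hxH => hxn ⟨H, hH, hxH⟩⟩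
    have hyR := h.1.2.2.1 hy
    have hyT : y ∉ convexHull ℝ (T : Set E3) := fun hyT =>
      (hP.triangle_subset_frontier hT hyT).2 hy.1
    have hco : (T : Set E3) = {a, b, c} := by simp [hTe]
    have haL : a ∈ affineSpan ℝ (T : Set E3) := subset_affineSpan ℝ _ haT
    rw [hco] at hx hyT
    obtain ⟨z, hz, hz'⟩ := exists_mem_edge hx (exists_coords haL hd hy.2) hyT
    have hzR := (convex_remainingPolygon hfr h.1.2.1).segment_subset hxR hyR hz
    rcases hz' with hz' | hz' | hz'
    · exact Set.disjoint_left.mp (hedge a haT b hbT hab) hz' hzR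
    · exact Set.disjoint_left.mp (hedge a haT c hcT hac) hz' hzR
    · exact Set.disjoint_left.mp (hedge b hbT c hcT hbc) hz' hzR

/-! ### Assembling the optimal solutions -/

theorem finite_facePlanes {𝒯 : Set (Finset E3)} (h : 𝒯.Finite) : (facePlanes 𝒯).Finite :=
  h.image fun T : Finset E3 => affineSpan ℝ (T : Set E3)

theorem carves_iUnion_of_isMinSeparation {P : Set E3} {𝒯 : Set (Finset E3)}
    (hP : IsTriangulatedPolytope P 𝒯) {𝓢 : AffineSubspace ℝ E3 → Set (Set E3)}
    (h : ∀ L ∈ facePlanes 𝒯,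
      IsMinSeparation L (crossSection P L) (triangleEdges (coplanarClass 𝒯 L)) (𝓢 L)) :
    Carves (⋃ L ∈ facePlanes 𝒯, 𝓢 L) P := by
  refine carves_of_frontier_subset
    ((finite_facePlanes hP.finite).biUnion fun L hL => (h L hL).1.1) ?_
    hP.isConnected_interior ?_ ?_
  · intro H hH
    obtain ⟨L, hL, hH⟩ := Set.mem_iUnion₂.mp hH
    exact ((h L hL).1.2.1 H hH).1
  · rintro x hx ⟨H, hH, hxH⟩
    obtain ⟨L, hL, hH⟩ := Set.mem_iUnion₂.mp hH
    exact ((h L hL).1.2.2.1 ⟨hx, ((h L hL).1.2.1 H hH).2 hxH⟩).2 H hH hxH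
  · rw [hP.frontier_eq]
    refine Set.iUnion₂_subset fun T hT => ?_
    have hL : affineSpan ℝ (T : Set E3) ∈ facePlanes 𝒯 := ⟨T, hT, rfl⟩
    exact (IsMinSeparation.triangle_subset hP hT (h _ hL)).trans
      (Set.sUnion_subset_sUnion (Set.subset_biUnion_of_mem (u := fun L => 𝓢 L) hL))

theorem ncard_iUnion_le_of_carves {P : Set E3} {𝒯 : Set (Finset E3)}
    (hP : IsTriangulatedPolytope P 𝒯) {𝓢 : AffineSubspace ℝ E3 → Set (Set E3)}
    (h : ∀ L ∈ facePlanes 𝒯,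
      IsMinSeparation L (crossSection P L) (triangleEdges (coplanarClass 𝒯 L)) (𝓢 L))
    {𝓗 : Set (Set E3)} (h𝓗 : Carves 𝓗 P) :
    (⋃ L ∈ facePlanes 𝒯, 𝓢 L).ncard ≤ 𝓗.ncard := by
  have hfin := finite_facePlanes hP.finite
  calc (⋃ L ∈ facePlanes 𝒯, 𝓢 L).ncard
      = (⋃ L ∈ hfin.toFinset, 𝓢 L).ncard := by simp
    _ ≤ ∑ L ∈ hfin.toFinset, (𝓢 L).ncard := Finset.set_ncard_biUnion_le _ _
    _ ≤ ∑ L ∈ hfin.toFinset, {H ∈ 𝓗 | H ⊆ (L : Set E3)}.ncard :=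
        Finset.sum_le_sum fun L hL =>
          (h L (hfin.mem_toFinset.mp hL)).2 _ (h𝓗.separates hP L)
    _ = (⋃ L ∈ hfin.toFinset, {H ∈ 𝓗 | H ⊆ (L : Set E3)}).ncard := by
        rw [← finsum_mem_coe_finset, ← Set.Finite.ncard_biUnion (Finset.finite_toSet _)]
        · simp
        · exact fun L _ => h𝓗.1.subset (Set.sep_subset _ _)
        -- Only the restrictions of `𝓗` must be disjoint; for the sets `𝓢 L` subadditivity suffices.
        · intro L hL L' hL' hne
          refine Set.disjoint_left.mpr fun H hH hH' => hne ?_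
          exact plane_unique (finrank_of_mem_facePlanes hP (by simpa using hL))
            (finrank_of_mem_facePlanes hP (by simpa using hL')) (h𝓗.2.1 H hH.1) hH.2 hH'.2
    _ ≤ 𝓗.ncard := Set.ncard_le_ncard
        (Set.iUnion₂_subset fun L _ => Set.sep_subset _ _) h𝓗.1

end PolytopeCarving

open PolytopeCarving in
theorem mainTheorem7 (P : Set E3) (𝒯 : Set (Finset E3)) (hP : IsTriangulatedPolytope P 𝒯)
    (hcarve : IsCarveable P) :
    (∀ L ∈ facePlanes 𝒯, ∃ 𝓚 : Set (Set E3),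
      IsMinSeparation L (crossSection P L) (triangleEdges (coplanarClass 𝒯 L)) 𝓚) ∧
    ∀ 𝓢 : AffineSubspace ℝ E3 → Set (Set E3),
      (∀ L ∈ facePlanes 𝒯,
        IsMinSeparation L (crossSection P L) (triangleEdges (coplanarClass 𝒯 L)) (𝓢 L)) →
      IsMinCarving (⋃ L ∈ facePlanes 𝒯, 𝓢 L) P := by
  refine ⟨fun L _ => ?_, fun 𝓢 h𝓢 =>
    ⟨carves_iUnion_of_isMinSeparation hP h𝓢, fun 𝓗 h𝓗 => ncard_iUnion_le_of_carves hP h𝓢 h𝓗⟩⟩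
  obtain ⟨𝓗, h𝓗⟩ := hcarve
  -- Restricting any carving gives a feasible solution, so one of least cardinality exists.
  obtain ⟨𝓚, h𝓚, hmin⟩ := exists_minimalFor_of_wellFoundedLT
    (Separates L (crossSection P L) (triangleEdges (coplanarClass 𝒯 L))) Set.ncard
    ⟨_, h𝓗.separates hP L⟩
  exact ⟨𝓚, h𝓚, fun 𝓚' h𝓚' => (le_total _ _).elim id fun hle => hmin h𝓚' hle⟩
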